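/- Let $\tilde Q_4=\{x\in\mathbb R^4: \tilde A x\ge -\mathbf 1\}$ with $$\tilde A=\begin{pmatrix}3&-3&-1&-2\\-3&3&-1&-2\\-2&1&-1&-3\\2&-1&-1&-3\\-3&-3&1&-2\\3&3&1&-2\\1&2&1&-3\\-1&-2&1&-3\\0&0&0&2\end{pmatrix},$$ the standard realization of the bounded Klee–Walkup polytope $Q_4$, with facets labelled $1,\dots,9$ by the rows. A realization of $Q_4$ is a bounded polyhedron $P=\{x\in\mathbb R^4: Ax\ge b\}$ with $A\in\mathbb R^{9\times 4}$, $b\in\mathbb R^9$, together with an isomorphism from the face lattice of $P$ to that of $\tilde Q_4$ which, for each $i$, sends the face of $P$ where the $i$-th inequality is tight to facet $i$ of $\tilde Q_4$. Write $V_{ijkl}$ for the vertex lying on the facets $i,j,k,l$. A circuit direction is a vector $g\neq 0$ such that the support of $Ag$ is inclusion-minimal among the supports of $Ah$, $h\ne 0$. A circuit walk of length $k$ from $u$ to $v$ is a sequence $u=y^0,\dots,y^k=v$ of points of $P$ such that for each $i<k$ there are a circuit direction $g$ and $\alpha>0$ with $y^{i+1}-y^i=\alpha g$ and $y^i+\beta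 g\notin P$ for all $\beta>\alpha$. A notion of diameter of $P$ is called Hirsch-sharp if its value is the number of facets minus the dimension. Then for every realization $P$ of $Q_4$: 1. $P$ has dimension $4$, nine facets and graph diameter $5=9-4$, so it is Hirsch-sharp for the graph diameter. 2. The face $F$ cut out by the facets $1$ and $4$ is a (bounded) 7-gon: it has dimension $2$ and seven vertices. If there is no circuit walk of length at most $2$ inside $F$ from $V_{1478}$ to $V_{1234}$, then there is a circuit walk of length at most $2$ inside $F$ from $V_{1234}$ to $V_{1478}$. 3. There is a circuit walk of length at most $4$ from $V_{1234}$ to $V_{5678}$, or one from $V_{5678}$ to $V_{1234}$. 4. Each of the following symmetric variants of the circuit diameter is at most $4$, hence not Hirsch-sharp: (a) the maximum over pairs of vertices $u,v$ of the smaller of the circuit distances from $u$ to $v$ and from $v$ to $u$; (b) the feasible circuit diameter, where walks stay in $P$ but steps $\alpha g$ need not be maximal; (c) the soft circuit diameter, where in addition walks may leave $P$ between their end vertices. -/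

import Mathlib

open scoped Matrix

noncomputable section

namespace KleeWalkup

variable {m n : Type*} [Fintype n]

/-- The polyhedron `{x | A x ≥ b}`. -/
def polyhedron (A : Matrix m n ℝ) (b : m → ℝ) : Set (n → ℝ) :=
  {x | ∀ i, b i ≤ (A *ᵥ x) i}

/-- The face of `{x | A x ≥ b}` on which the inequalities with index in `I` are tight. -/
def face (A : Matrix m n ℝ) (b : m → ℝ) (I : Set m) : Set (n → ℝ) :=
  {x | x ∈ polyhedron A b ∧ ∀ i ∈ I, (A *ᵥ x) i = b i}

/-- The face lattice of `P` (ordered by inclusion; `∅` and `P` are faces). -/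
abbrev Faces (P : Set (n → ℝ)) : Type _ := {F : Set (n → ℝ) // IsExposed ℝ P F}

/-- Combinatorial equivalence of two polyhedra given by systems of inequalities with the same
index set: an isomorphism of face lattices that respects the labels of the inequalities. -/
def CombinatoriallyEquivalent (A : Matrix m n ℝ) (b : m → ℝ) (A' : Matrix m n ℝ) (b' : m → ℝ) :
    Prop :=
  ∃ Φ : Faces (polyhedron A b) ≃o Faces (polyhedron A' b'),
    ∀ (i : m) (F : Faces (polyhedron A b)),
      (F : Set (n → ℝ)) = face A b {i} ↔ (Φ F : Set (n → ℝ)) = face A' b' {i}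

/-- The dimension of a (nonempty) polyhedron. -/
def dim (P : Set (n → ℝ)) : ℕ := Module.finrank ℝ (vectorSpan ℝ P)

/-- The number of facets, i.e. of faces of codimension one. -/
def numFacets (P : Set (n → ℝ)) : ℕ :=
  {F : Set (n → ℝ) | IsExposed ℝ P F ∧ F.Nonempty ∧ dim F + 1 = dim P}.ncard

/-- A value `δ` of some notion of diameter of `P` is Hirsch-sharp if it equals
(number of facets) - (dimension). -/
def IsHirschSharp (P : Set (n → ℝ)) (δ : ℕ∞) : Prop :=
  δ + (dim P : ℕ∞) = (numFacets P : ℕ∞)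

/-- The vertex-edge graph (skeleton) of `P`. -/
def skeleton (P : Set (n → ℝ)) : SimpleGraph (P.extremePoints ℝ) where
  Adj u v := u ≠ v ∧ IsExposed ℝ P (segment ℝ (u : n → ℝ) v)
  symm := ⟨fun u v h => ⟨h.1.symm, by rw [segment_symm]; exact h.2⟩⟩
  loopless := ⟨fun _ h => h.1 rfl⟩

/-- The graph diameter of `P`. -/
def graphDiam (P : Set (n → ℝ)) : ℕ∞ := (skeleton P).ediam

/-- Circuit directions of `A`: the nonzero vectors `g` for which `A g` has inclusion-minimal
support. They are taken up to scaling, which does not affect circuit walks. -/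
def circuits (A : Matrix m n ℝ) : Set (n → ℝ) :=
  {g | g ≠ 0 ∧ ∀ h : n → ℝ, h ≠ 0 →
    Function.support (A *ᵥ h) ⊆ Function.support (A *ᵥ g) →
    Function.support (A *ᵥ h) = Function.support (A *ᵥ g)}

/-- A step along a circuit direction, without any requirement on feasibility or step length. -/
def CircuitStep (A : Matrix m n ℝ) (x y : n → ℝ) : Prop :=
  ∃ g ∈ circuits A, ∃ α : ℝ, 0 < α ∧ y - x = α • g

/-- A step along a circuit direction that is traversed as far as feasibility allows. -/
def MaximalCircuitStep (A : Matrix m n ℝ) (b : m → ℝ) (x y : n → ℝ) : Prop :=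
  ∃ g ∈ circuits A, ∃ α : ℝ, 0 < α ∧ y - x = α • g ∧
    ∀ β : ℝ, α < β → x + β • g ∉ polyhedron A b

/-- There is a walk with `k` steps from `u` to `v`, all of whose points lie in `S` and all of
whose steps satisfy `R`. -/
def HasWalk {E : Type*} (S : Set E) (R : E → E → Prop) (k : ℕ) (u v : E) : Prop :=
  ∃ y : Fin (k + 1) → E, y 0 = u ∧ y (Fin.last k) = v ∧ (∀ i, y i ∈ S) ∧
    ∀ i : Fin k, R (y i.castSucc) (y i.succ)

/-- There is a circuit walk of length `k` from `u` to `v`. -/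
def HasCircuitWalk (A : Matrix m n ℝ) (b : m → ℝ) (k : ℕ) (u v : n → ℝ) : Prop :=
  HasWalk (polyhedron A b) (MaximalCircuitStep A b) k u v

/-- There is a circuit walk of length `k` from `u` to `v` that stays in the face `face A b I`. -/
def HasCircuitWalkInFace (A : Matrix m n ℝ) (b : m → ℝ) (I : Set m) (k : ℕ) (u v : n → ℝ) :
    Prop :=
  HasWalk (face A b I) (MaximalCircuitStep A b) k u v

/-- The length of a shortest walk (`⊤` if there is none). -/
def walkDist {E : Type*} (S : Set E) (R : E → E → Prop) (u v : E) : ℕ∞ :=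
  ⨅ (k : ℕ) (_ : HasWalk S R k u v), (k : ℕ∞)

/-- The circuit distance from `u` to `v`. It is not symmetric. -/
def circuitDist (A : Matrix m n ℝ) (b : m → ℝ) (u v : n → ℝ) : ℕ∞ :=
  walkDist (polyhedron A b) (MaximalCircuitStep A b) u v

/-- The symmetrized circuit diameter: the largest value, over pairs of vertices, of the smaller
one of the two circuit distances between them. -/
def symmCircuitDiam (A : Matrix m n ℝ) (b : m → ℝ) : ℕ∞ :=
  ⨆ u ∈ (polyhedron A b).extremePoints ℝ, ⨆ v ∈ (polyhedron A b).extremePoints ℝ,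
    min (circuitDist A b u v) (circuitDist A b v u)

/-- The feasible circuit diameter: walks stay in the polyhedron, but steps need not be maximal. -/
def feasibleCircuitDiam (A : Matrix m n ℝ) (b : m → ℝ) : ℕ∞ :=
  ⨆ u ∈ (polyhedron A b).extremePoints ℝ, ⨆ v ∈ (polyhedron A b).extremePoints ℝ,
    walkDist (polyhedron A b) (CircuitStep A) u v

/-- The soft circuit diameter: walks between vertices may leave the polyhedron, and steps need not
be maximal. -/
def softCircuitDiam (A : Matrix m n ℝ) (b : m → ℝ) : ℕ∞ :=
  ⨆ u ∈ (polyhedron A b).extremePoints ℝ, ⨆ v ∈ (polyhedron A b).extremePoints ℝ,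
    walkDist Set.univ (CircuitStep A) u v

/-- The constraint matrix of the standard realization of the Klee-Walkup polytope. The facets
labelled `1, …, 9` correspond to the row indices `0, …, 8`. -/
def stdMatrix : Matrix (Fin 9) (Fin 4) ℝ :=
  !![ 3, -3, -1, -2;
     -3,  3, -1, -2;
     -2,  1, -1, -3;
      2, -1, -1, -3;
     -3, -3,  1, -2;
      3,  3,  1, -2;
      1,  2,  1, -3;
     -1, -2,  1, -3;
      0,  0,  0,  2]

/-- The right-hand side of the standard realization of the Klee-Walkup polytope. -/
def stdRhs : Fin 9 → ℝ := fun _ => -1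

/-- `{x | A x ≥ b}` is a realization of the Klee-Walkup polytope `Q₄`: it is bounded, and it is
combinatorially equivalent to the standard realization. -/
def IsRealization (A : Matrix (Fin 9) (Fin 4) ℝ) (b : Fin 9 → ℝ) : Prop :=
  Bornology.IsBounded (polyhedron A b) ∧ CombinatoriallyEquivalent A b stdMatrix stdRhs

end KleeWalkup

end

open scoped Matrix

/-! ### Combinatorial data, and their verification on the standard realization. -/

namespace KleeWalkup
-- The combinatorics of `Q₄` is a finite table: 27 vertices, each on exactly four facets. Exact
-- rational vertices and infeasible triples of facets show that the table describes the standard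
-- realization (`std_face_nonempty_iff`). A label-preserving isomorphism of face lattices preserves
-- emptiness and inclusion of the faces `face A b I`, so every realization has the same vertices,
-- edges and face dimensions. In particular all pairs of vertices are at graph distance at most 4,
-- except V1234 and V5678, which are at distance 5.
--
-- An edge traversed from end to end is a maximal circuit step, so only this pair needs an argument.
-- V1478 is two edges away from V5678 and shares with V1234 the 7-gon on facets 1 and 4, where
-- V1234, V1345, V1458, V1478 are consecutive. The middle edge lies on facet 5. Start from whichever
-- of V1234 and V1478 has the smaller slack in facet 5 and move parallel to the middle edge: this
-- ends on the edge at the other vertex, and a second step along that edge arrives there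
-- (`exists_walk_of_le`). Which direction works depends on the realization, but one always does, and
-- 2 + 2 = 4.
--
-- If steps need not be maximal, walks can be reversed, so the bound holds for both directions; the
-- soft distance is at most the feasible one.
/-- The labels of the facets through each of the 27 vertices of the Klee-Walkup polytope. -/
def vertexLabel : Fin 27 → Finset (Fin 9) := ![
  {0, 1, 2, 3}, {0, 1, 2, 8}, {0, 1, 3, 8}, {0, 2, 3, 4}, {0, 2, 4, 8}, {0, 3, 4, 7},
  {0, 3, 5, 6}, {0, 3, 5, 8}, {0, 3, 6, 7}, {0, 4, 7, 8}, {0, 5, 6, 7}, {0, 5, 7, 8},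
  {1, 2, 3, 5}, {1, 2, 4, 7}, {1, 2, 4, 8}, {1, 2, 5, 6}, {1, 2, 6, 7}, {1, 3, 5, 8},
  {1, 4, 6, 7}, {1, 4, 6, 8}, {1, 5, 6, 8}, {2, 3, 4, 7}, {2, 3, 5, 6}, {2, 3, 6, 7},
  {4, 5, 6, 7}, {4, 5, 6, 8}, {4, 5, 7, 8}]

/-- The minimal sets of facets of the Klee-Walkup polytope without a common point. -/
def missingFace : Fin 30 → Finset (Fin 9) := ![
  {0, 1, 4}, {0, 1, 5}, {0, 1, 6}, {0, 1, 7}, {0, 2, 5}, {0, 2, 6}, {0, 2, 7}, {0, 4, 5},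
  {0, 4, 6}, {0, 6, 8}, {1, 3, 4}, {1, 3, 6}, {1, 3, 7}, {1, 4, 5}, {1, 5, 7}, {1, 7, 8},
  {2, 3, 8}, {2, 4, 5}, {2, 4, 6}, {2, 5, 7}, {2, 5, 8}, {2, 6, 8}, {2, 7, 8}, {3, 4, 5},
  {3, 4, 6}, {3, 4, 8}, {3, 5, 7}, {3, 6, 8}, {3, 7, 8}, {6, 7, 8}]

/-- A set of facets of the Klee-Walkup polytope with a common vertex. -/
def IsFaceLabel (I : Finset (Fin 9)) : Prop := ∃ s, I ⊆ vertexLabel s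

instance : DecidablePred IsFaceLabel := fun _ => inferInstanceAs (Decidable (∃ _, _))

/-- Graph distances between the vertices of the Klee-Walkup polytope: the base-8 digits of the
`s`-th entry are the distances from the `s`-th vertex. -/
def distTable : Fin 27 → ℕ := ![
  1385594256205155541000776, 1041534647015080425526337, 1041533654257775820776457,
  1078115839806135904014481, 734055095709495857316490, 733383232963281016070874,
  1030762036685507747989147, 733924973461570178102866, 1030237459405939656668387,
  389322486861681514026195, 686102910569225254156004, 389257921010493267977883,
  1342436924944678153467025, 1030890843560195143050451, 998506303377507460682890,
  997702858578770881300186, 1030234828660493884700443, 998376178882661052986962,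
  686165996384795029780252, 653707669190636861531859, 653642112512355751311515,
  1072720151120021153424090, 1337041254559383598515930, 1374295591123976112911651,
  342032924768959128516901, 309574597539547870771420, 45187937431240630413020]

/-- The graph distance between two vertices of the Klee-Walkup polytope. -/
def tableDist (s t : Fin 27) : ℕ := distTable s / 8 ^ (t : ℕ) % 8

/-- Makes the two certificates exhaustive: a vertex witnesses that a face is nonempty, a missing
face that it is empty. -/
theorem isFaceLabel_or_missingFace_subset :
    ∀ I : Finset (Fin 9), IsFaceLabel I ∨ ∃ t, missingFace t ⊆ I := by
  decide +kernel

theorem card_vertexLabel : ∀ s, (vertexLabel s).card = 4 := by decide +kernel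

theorem vertexLabel_injective : Function.Injective vertexLabel := by decide +kernel

/-- Together with `exists_third_vertex`, this recognises edges: two vertices span an edge exactly
when they share three labels, and otherwise the smallest face containing both has a third vertex. -/
theorem eq_or_eq_of_inter_subset : ∀ s t u, (vertexLabel s ∩ vertexLabel t).card = 3 →
    vertexLabel s ∩ vertexLabel t ⊆ vertexLabel u → u = s ∨ u = t := by
  decide +kernel

theorem exists_third_vertex : ∀ s t, s ≠ t → (vertexLabel s ∩ vertexLabel t).card ≠ 3 →
    ∃ u, u ≠ s ∧ u ≠ t ∧ vertexLabel s ∩ vertexLabel t ⊆ vertexLabel u := by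
  decide +kernel

/-- Descending to a neighbour bounds the graph distance above by the table; `tableDist_le_succ`,
with zeros on the diagonal, bounds it below. -/
theorem exists_tableDist_lt : ∀ s t, s ≠ t →
    ∃ u, (vertexLabel s ∩ vertexLabel u).card = 3 ∧ tableDist u t < tableDist s t := by
  decide +kernel

theorem tableDist_le_succ : ∀ s t u, (vertexLabel s ∩ vertexLabel t).card = 3 →
    tableDist s u ≤ tableDist t u + 1 := by
  decide +kernel

theorem tableDist_le : ∀ s t, tableDist s t ≤ 5 := by decide +kernel

theorem tableDist_le_four : ∀ s t, tableDist s t ≤ 4 ∨ (s = 0 ∧ t = 24) ∨ (s = 24 ∧ t = 0) := by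
  decide +kernel

/-- Numerators of the vertices of the standard realization. -/
def stdNum : Matrix (Fin 27) (Fin 4) ℤ := !![
  0, 0, 1, 0; 1, 1, 4, -1; -1, -1, 4, -1; 1, 2, 3, 3;
  19, 20, 57, -15; 1, 3, 3, 5; -3, 1, -3, 5; -8, -7, 21, -6;
  -4, 2, -5, 8; -7, 8, -21, -6; -2, 1, -3, 3; -20, 19, -57, -15;
  -1, -2, 3, 3; 3, -1, -3, 5; 8, 7, 21, -6; -1, -3, 3, 5;
  4, -2, -5, 8; -19, -20, 57, -15; 2, -1, -3, 3; 20, -19, -57, -15;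
  7, -8, -21, -6; 2, 4, 5, 8; -2, -4, 5, 8; 0, 0, 0, 1;
  0, 0, -1, 0; 1, -1, -4, -1; -1, 1, -4, -1]

/-- Denominators of the vertices of the standard realization. -/
def stdDen : Fin 27 → ℤ := ![
  1, 2, 2, 12, 30, 19, 19, 12, 29, 12, 12, 30, 12, 19, 12, 19, 29, 30, 12, 30, 12, 29, 29, 3, 1,
  2, 2]

/-- The constraint matrix of the standard realization, over the integers. -/
def intMatrix : Matrix (Fin 9) (Fin 4) ℤ :=
  !![3, -3, -1, -2; -3, 3, -1, -2; -2, 1, -1, -3; 2, -1, -1, -3; -3, -3, 1, -2; 3, 3, 1, -2;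
    1, 2, 1, -3; -1, -2, 1, -3; 0, 0, 0, 2]

theorem stdDen_pos : ∀ s, 0 < stdDen s := by decide +kernel

theorem std_slack : ∀ s i, -stdDen s ≤ (intMatrix *ᵥ stdNum s) i ∧
    (-stdDen s = (intMatrix *ᵥ stdNum s) i ↔ i ∈ vertexLabel s) := by
  decide +kernel

theorem stdMatrix_eq : stdMatrix = intMatrix.map (Int.castRingHom ℝ) := by
  ext i j
  fin_cases i <;> fin_cases j <;> simp [stdMatrix, intMatrix]

theorem std_vertex (s : Fin 27) : ∃ x : Fin 4 → ℝ, x ∈ polyhedron stdMatrix stdRhs ∧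
    ∀ i, (stdMatrix *ᵥ x) i = stdRhs i ↔ i ∈ vertexLabel s := by
  have hd : (0 : ℝ) < stdDen s := by exact_mod_cast stdDen_pos s
  have key (i : Fin 9) : (stdMatrix *ᵥ ((stdDen s : ℝ)⁻¹ • fun j => (stdNum s j : ℝ))) i =
      (stdDen s : ℝ)⁻¹ * ((intMatrix *ᵥ stdNum s) i : ℤ) := by
    rw [Matrix.mulVec_smul, Pi.smul_apply, smul_eq_mul, stdMatrix_eq]
    congr 1
    exact (RingHom.map_mulVec (Int.castRingHom ℝ) intMatrix (stdNum s) i).symm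
  have hneg : -1 = (stdDen s : ℝ)⁻¹ * ((-stdDen s : ℤ) : ℝ) := by
    push_cast; field_simp
  refine ⟨(stdDen s : ℝ)⁻¹ • fun j => (stdNum s j : ℝ), fun i => ?_, fun i => ?_⟩
  · rw [key, stdRhs, hneg]
    exact mul_le_mul_of_nonneg_left (by exact_mod_cast (std_slack s i).1) (by positivity)
  · rw [key, stdRhs, hneg, ← (std_slack s i).2, mul_right_inj' (by positivity), Int.cast_inj]
    exact eq_comm

theorem std_missingFace (t : Fin 30) (x : Fin 4 → ℝ) (hx : x ∈ polyhedron stdMatrix stdRhs)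
    (h : ∀ i ∈ missingFace t, (stdMatrix *ᵥ x) i = stdRhs i) : False := by
  have h0 := hx 0
  have h1 := hx 1
  have h2 := hx 2
  have h3 := hx 3
  have h4 := hx 4
  have h5 := hx 5
  have h6 := hx 6
  have h7 := hx 7
  have h8 := hx 8
  simp [stdMatrix, stdRhs, Matrix.mulVec, dotProduct, Fin.sum_univ_four] at h0 h1 h2 h3 h4 h5 h6 h7 h8
  fin_cases t <;>
  · simp [missingFace, stdMatrix, stdRhs, Matrix.mulVec, dotProduct, Fin.sum_univ_four] at h
    -- Every missing face has three labels; their equalities contradict the nine inequalities by a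
    -- Farkas combination.
    linarith [h.1, h.2.1, h.2.2]

end KleeWalkup
namespace KleeWalkup

/-! ### Faces, extreme points and circuit directions of a general polyhedron. -/

section Polyhedron

variable {m n : Type*} [Fintype n] {A : Matrix m n ℝ} {b : m → ℝ}

theorem convex_polyhedron (A : Matrix m n ℝ) (b : m → ℝ) : Convex ℝ (polyhedron A b) := by
  intro x hx y hy s t hs ht hst i
  rw [Matrix.mulVec_add, Matrix.mulVec_smul, Matrix.mulVec_smul]
  simp only [Pi.add_apply, Pi.smul_apply, smul_eq_mul]
  have h1 := mul_le_mul_of_nonneg_left (hx i) hs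
  have h2 := mul_le_mul_of_nonneg_left (hy i) ht
  have h3 : b i = s * b i + t * b i := by rw [← add_mul, hst, one_mul]
  linarith

theorem continuous_mulVec_apply (A : Matrix m n ℝ) (i : m) :
    Continuous fun x : n → ℝ => (A *ᵥ x) i := by
  simp only [Matrix.mulVec, dotProduct]
  fun_prop

theorem isClosed_polyhedron (A : Matrix m n ℝ) (b : m → ℝ) : IsClosed (polyhedron A b) := by
  simp only [polyhedron, Set.ofPred_forall]
  exact isClosed_iInter fun i => isClosed_le continuous_const (continuous_mulVec_apply A i)

theorem face_subset (A : Matrix m n ℝ) (b : m → ℝ) (I : Set m) : face A b I ⊆ polyhedron A b :=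
  fun _ h => h.1

theorem face_empty (A : Matrix m n ℝ) (b : m → ℝ) : face A b ∅ = polyhedron A b := by
  simp [face]

theorem face_anti {I J : Set m} (h : I ⊆ J) : face A b J ⊆ face A b I :=
  fun _ hx => ⟨hx.1, fun i hi => hx.2 i (h hi)⟩

/-- The sum of the rows in `I` is bounded below on the polyhedron by the sum of the `b i`, with
equality exactly when all of them are tight; its negative is the exposing functional. -/
theorem isExposed_face [Fintype m] (A : Matrix m n ℝ) (b : m → ℝ) (I : Set m) :
    IsExposed ℝ (polyhedron A b) (face A b I) := by
  classical
  rintro ⟨x₀, hx₀⟩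
  let l : (n → ℝ) →ₗ[ℝ] ℝ :=
    -∑ i ∈ I.toFinset, (LinearMap.proj i : (m → ℝ) →ₗ[ℝ] ℝ) ∘ₗ Matrix.mulVecLin A
  have hl (x : n → ℝ) : l x = -∑ i ∈ I.toFinset, (A *ᵥ x) i := by
    simp [l]
  have hle (y : n → ℝ) (hy : y ∈ polyhedron A b) : ∑ i ∈ I.toFinset, b i ≤
      ∑ i ∈ I.toFinset, (A *ᵥ y) i := Finset.sum_le_sum fun i _ => hy i
  have heq (y : n → ℝ) (hy : y ∈ face A b I) : ∑ i ∈ I.toFinset, b i =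
      ∑ i ∈ I.toFinset, (A *ᵥ y) i :=
    Finset.sum_congr rfl fun i hi => (hy.2 i (by simpa using hi)).symm
  refine ⟨LinearMap.toContinuousLinearMap l, ?_⟩
  ext x
  simp only [LinearMap.coe_toContinuousLinearMap', hl, Set.mem_ofPred_eq, neg_le_neg_iff]
  refine ⟨fun hx => ⟨hx.1, fun y hy => (heq x hx) ▸ hle y hy⟩, fun ⟨hx, h⟩ => ⟨hx, ?_⟩⟩
  have h1 := h x₀ hx₀.1
  rw [← heq x₀ hx₀] at h1
  have h2 := (Finset.sum_eq_sum_iff_of_le fun i _ => hx i).1 (le_antisymm (hle x hx) h1)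
  exact fun i hi => (h2 i (by simpa using hi)).symm

/-- The inequalities that are tight at `x`. -/
def tight (A : Matrix m n ℝ) (b : m → ℝ) (x : n → ℝ) : Set m := {i | (A *ᵥ x) i = b i}

theorem mem_face_iff {I : Set m} {x : n → ℝ} :
    x ∈ face A b I ↔ x ∈ polyhedron A b ∧ I ⊆ tight A b x := Iff.rfl

theorem mem_face_tight {x : n → ℝ} (hx : x ∈ polyhedron A b) : x ∈ face A b (tight A b x) :=
  ⟨hx, fun _ h => h⟩

theorem tight_midpoint {x y : n → ℝ} (hx : x ∈ polyhedron A b) (hy : y ∈ polyhedron A b) :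
    tight A b (midpoint ℝ x y) = tight A b x ∩ tight A b y := by
  ext i
  have h1 := hx i
  have h2 := hy i
  have h3 : (A *ᵥ midpoint ℝ x y) i = ((A *ᵥ x) i + (A *ᵥ y) i) / 2 := by
    rw [midpoint_eq_smul_add, Matrix.mulVec_smul, Matrix.mulVec_add]
    simp only [Pi.smul_apply, Pi.add_apply, smul_eq_mul, invOf_eq_inv]
    ring
  simp only [tight, Set.mem_ofPred_eq, Set.mem_inter_iff, h3]
  constructor
  · intro h; constructor <;> linarith
  · rintro ⟨h, h'⟩; linarith

/-- A nonempty convex subset of a polyhedron has a point at which the fewest possible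
inequalities are tight. -/
theorem exists_tight_subset [Finite m] {S : Set (n → ℝ)} (hS : S ⊆ polyhedron A b)
    (hc : Convex ℝ S) (hne : S.Nonempty) :
    ∃ x ∈ S, ∀ y ∈ S, tight A b x ⊆ tight A b y := by
  obtain ⟨x, hx, hmin⟩ := Set.exists_min_image (tight A b '' S) Set.ncard (Set.toFinite _)
    (hne.image _)
  obtain ⟨x, hxS, rfl⟩ := hx
  refine ⟨x, hxS, fun y hy => ?_⟩
  -- At the midpoint only the constraints tight at both points are tight, so minimality at `x`
  -- leaves none to lose.
  have hm := hmin _ (Set.mem_image_of_mem _ (hc.midpoint_mem hxS hy))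
  rw [tight_midpoint (hS hxS) (hS hy)] at hm
  exact Set.inter_eq_left.1 (Set.eq_of_subset_of_ncard_le Set.inter_subset_left hm)

theorem eventually_add_smul_mem [Finite m] {x d : n → ℝ} (hx : x ∈ polyhedron A b)
    (hd : ∀ i ∈ tight A b x, (A *ᵥ d) i = 0) :
    ∃ ε > 0, ∀ t : ℝ, |t| ≤ ε → x + t • d ∈ polyhedron A b := by
  have key : ∀ i, ∀ᶠ t in nhds (0 : ℝ), b i ≤ (A *ᵥ (x + t • d)) i := by
    intro i
    simp only [Matrix.mulVec_add, Matrix.mulVec_smul, Pi.add_apply, Pi.smul_apply, smul_eq_mul]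
    by_cases hi : i ∈ tight A b x
    · rw [hd i hi]
      exact Filter.Eventually.of_forall fun t => by simpa using hx i
    · have hlt : b i < (A *ᵥ x) i + 0 * (A *ᵥ d) i := by
        simpa using lt_of_le_of_ne (hx i) fun h => hi h.symm
      have hcont : Continuous fun t : ℝ => (A *ᵥ x) i + t * (A *ᵥ d) i := by fun_prop
      exact (hcont.tendsto 0).eventually (lt_mem_nhds hlt) |>.mono fun t ht => ht.le
  obtain ⟨ε, hε, h⟩ := Metric.eventually_nhds_iff.1 (Filter.eventually_all.2 key)
  refine ⟨ε / 2, by positivity, fun t ht => h ?_⟩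
  rw [Real.dist_eq, sub_zero]
  linarith

/-- The point `x` is relatively interior: if the exposing functional dropped from `x` to some `y` in
the face of its tight constraints, then a small step from `x` away from `y` would stay feasible and
increase it. -/
theorem isExposed_eq_face [Finite m] {F : Set (n → ℝ)} (hF : IsExposed ℝ (polyhedron A b) F)
    {x : n → ℝ} (hx : x ∈ F) (hmin : ∀ y ∈ F, tight A b x ⊆ tight A b y) :
    F = face A b (tight A b x) := by
  refine Set.Subset.antisymm (fun y hy => ⟨hF.subset hy, hmin y hy⟩) fun y hy => ?_
  obtain ⟨l, rfl⟩ := hF ⟨x, hx⟩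
  refine ⟨hy.1, fun z hz => (hx.2 z hz).trans ?_⟩
  obtain ⟨ε, hε, h⟩ := eventually_add_smul_mem (d := y - x) hx.1 fun i hi => by
    rw [Matrix.mulVec_sub, Pi.sub_apply, hy.2 i hi, hi, sub_self]
  have h1 := hx.2 _ (h (-ε) (by rw [abs_neg, abs_of_pos hε]))
  rw [map_add, map_smul, map_sub, smul_eq_mul] at h1
  by_contra! h2
  nlinarith [mul_pos hε (sub_pos.2 h2)]

theorem extremePoints_face [Finite m] (I : Set m) :
    (face A b I).extremePoints ℝ = face A b I ∩ (polyhedron A b).extremePoints ℝ := by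
  have := Fintype.ofFinite m
  exact (isExposed_face A b I).isExtreme.extremePoints_eq

theorem face_tight_eq_singleton [Finite m] {x : n → ℝ}
    (hx : x ∈ (polyhedron A b).extremePoints ℝ) : face A b (tight A b x) = {x} := by
  refine Set.Subset.antisymm (fun y hy => ?_) (Set.singleton_subset_iff.2 (mem_face_tight hx.1))
  obtain ⟨ε, hε, h⟩ := eventually_add_smul_mem (d := y - x) hx.1 fun i hi => by
    rw [Matrix.mulVec_sub, Pi.sub_apply, hy.2 i hi, hi, sub_self]
  have h1 := hx.2 (h ε (abs_of_pos hε).le) (h (-ε) (by rw [abs_neg, abs_of_pos hε]))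
    ⟨1 / 2, 1 / 2, by norm_num, by norm_num, by norm_num, by
      ext j; simp only [Pi.add_apply, Pi.smul_apply, Pi.sub_apply, smul_eq_mul]; ring⟩
  have h2 : ε • (y - x) = 0 := by simpa using h1
  exact sub_eq_zero.1 ((smul_eq_zero.1 h2).resolve_left hε.ne')

theorem mem_extremePoints_of_face_eq [Finite m] {I : Set m} {x : n → ℝ}
    (h : face A b I = {x}) : x ∈ (polyhedron A b).extremePoints ℝ := by
  have : x ∈ (face A b I).extremePoints ℝ := by simp [h]
  rw [extremePoints_face] at this
  exact this.2

/-- At an edge, the tight inequalities determine the direction. -/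
theorem exists_eq_smul_of_edge [Finite m] {I : Set m} {u v x d : n → ℝ}
    (he : face A b I = segment ℝ u v) (hx : x ∈ polyhedron A b) (hxI : tight A b x = I)
    (hd : ∀ i ∈ I, (A *ᵥ d) i = 0) : ∃ c : ℝ, d = c • (v - u) := by
  obtain ⟨ε, hε, h⟩ := eventually_add_smul_mem (d := d) hx (hxI ▸ hd)
  have h1 : x ∈ segment ℝ u v := he ▸ ⟨hx, hxI.ge⟩
  have h2 : x + ε • d ∈ segment ℝ u v := by
    rw [← he]
    refine ⟨h ε (abs_of_pos hε).le, fun i hi => ?_⟩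
    have hi' : (A *ᵥ x) i = b i := hxI.ge hi
    rw [Matrix.mulVec_add, Matrix.mulVec_smul, Pi.add_apply, Pi.smul_apply, hd i hi, hi',
      smul_zero, add_zero]
  rw [segment_eq_image'] at h1 h2
  obtain ⟨s, -, hs⟩ := h1
  obtain ⟨t, -, ht⟩ := h2
  refine ⟨ε⁻¹ * (t - s), ?_⟩
  have h3 : ε • d = (t - s) • (v - u) := by
    rw [sub_smul, ← add_sub_add_left_eq_sub _ _ u]
    simp only at hs ht
    rw [hs, ht, add_sub_cancel_left]
  rw [mul_smul, ← h3, inv_smul_smul₀ hε.ne']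

/-- A vector whose image has smaller or equal support vanishes on the constraints defining the edge,
hence is parallel to it and has the same support. -/
theorem sub_mem_circuits [Finite m] {I : Set m} {u v x : n → ℝ}
    (he : face A b I = segment ℝ u v) (hx : x ∈ polyhedron A b) (hxI : tight A b x = I)
    (huv : u ≠ v) : v - u ∈ circuits A := by
  have hg : ∀ i ∈ I, (A *ᵥ (v - u)) i = 0 := fun i hi => by
    have hu : u ∈ face A b I := he ▸ left_mem_segment ℝ u v
    have hv : v ∈ face A b I := he ▸ right_mem_segment ℝ u v
    rw [Matrix.mulVec_sub, Pi.sub_apply, hu.2 i hi, hv.2 i hi, sub_self]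
  refine ⟨sub_ne_zero.2 huv.symm, fun h hh hsub => ?_⟩
  obtain ⟨c, rfl⟩ := exists_eq_smul_of_edge (d := h) he hx hxI fun i hi => by
    by_contra hne
    exact hsub (Function.mem_support.2 hne) (hg i hi)
  have hc : c ≠ 0 := by rintro rfl; simp at hh
  ext i
  simp [Matrix.mulVec_smul, hc]

/-- Row `j` vanishes on the direction space of the face but not on `y - x` for `x` in the face. -/
theorem dim_lt_of_ssubset [Finite m] {I : Set m} {G : Set (n → ℝ)} {j : m}
    (hG : face A b I ⊆ G) (hne : (face A b I).Nonempty) (hj : j ∈ I)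
    {y : n → ℝ} (hy : y ∈ G) (hjy : (A *ᵥ y) j ≠ b j) : dim (face A b I) < dim G := by
  obtain ⟨x, hx⟩ := hne
  refine Submodule.finrank_lt_finrank_of_lt (lt_of_le_of_ne (vectorSpan_mono ℝ hG) fun h => ?_)
  have h1 : y - x ∈ vectorSpan ℝ (face A b I) := by
    rw [h]; exact vsub_mem_vectorSpan ℝ hy (hG hx)
  have h2 : vectorSpan ℝ (face A b I) ≤
      LinearMap.ker ((LinearMap.proj j : (m → ℝ) →ₗ[ℝ] ℝ) ∘ₗ Matrix.mulVecLin A) := by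
    refine Submodule.span_le.2 ?_
    rintro _ ⟨p, hp, q, hq, rfl⟩
    simp [Matrix.mulVec_sub, hp.2 j hj, hq.2 j hj]
  have h3 : (A *ᵥ (y - x)) j = 0 := h2 h1
  rw [Matrix.mulVec_sub, Pi.sub_apply, hx.2 j hj] at h3
  exact hjy (sub_eq_zero.1 h3)

/-- A longer feasible step would put the extreme point `y` strictly inside a segment of the
polyhedron. -/
theorem not_mem_polyhedron_of_extreme {x y g : n → ℝ} {α β : ℝ} (hx : x ∈ polyhedron A b)
    (hy : y ∈ (polyhedron A b).extremePoints ℝ) (hα : 0 < α) (hg : g ≠ 0) (h : y - x = α • g)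
    (hβ : α < β) : x + β • g ∉ polyhedron A b := by
  intro hz
  have hβ0 : 0 < β := hα.trans hβ
  have h1 := hy.2 hx hz ⟨1 - α / β, α / β, by rw [sub_pos, div_lt_one hβ0]; exact hβ,
    by positivity, by ring, by
      rw [eq_add_of_sub_eq h, smul_add, smul_smul, div_mul_cancel₀ _ hβ0.ne', sub_smul, one_smul]
      abel⟩
  rw [h1, sub_self] at h
  exact (smul_ne_zero hα.ne' hg) h.symm

theorem maximalCircuitStep_of_extreme {x y g : n → ℝ} {α : ℝ} (hx : x ∈ polyhedron A b)
    (hy : y ∈ (polyhedron A b).extremePoints ℝ) (hα : 0 < α) (hg : g ∈ circuits A)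
    (h : y - x = α • g) : MaximalCircuitStep A b x y :=
  ⟨g, hg, α, hα, h, fun _ hβ => not_mem_polyhedron_of_extreme hx hy hα hg.1 h hβ⟩

theorem maximalCircuitStep_of_tight {x y g : n → ℝ} {α : ℝ} {j : m} (hα : 0 < α)
    (hg : g ∈ circuits A) (h : y - x = α • g) (hj : (A *ᵥ y) j = b j) (hgj : (A *ᵥ g) j < 0) :
    MaximalCircuitStep A b x y := by
  refine ⟨g, hg, α, hα, h, fun β hβ hz => ?_⟩
  have h1 := hz j
  rw [show x + β • g = y + (β - α) • g by rw [sub_smul, ← h]; abel, Matrix.mulVec_add,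
    Matrix.mulVec_smul, Pi.add_apply, Pi.smul_apply, hj, smul_eq_mul] at h1
  nlinarith [mul_pos (sub_pos.2 hβ) (neg_pos.2 hgj)]

end Polyhedron

/-! ### Concatenation and reversal of walks. -/

section Walk

variable {E : Type*} {S S' : Set E} {R R' : E → E → Prop} {k l : ℕ} {u v w : E}

theorem hasWalk_zero (hu : u ∈ S) : HasWalk S R 0 u u :=
  ⟨fun _ => u, rfl, rfl, fun _ => hu, fun i => i.elim0⟩

theorem hasWalk_succ_iff : HasWalk S R (k + 1) u v ↔ u ∈ S ∧ ∃ w, R u w ∧ HasWalk S R k w v := by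
  constructor
  · rintro ⟨y, rfl, rfl, hS, hR⟩
    exact ⟨hS 0, y 1, hR 0, fun i => y i.succ, rfl, rfl, fun i => hS _, fun i => hR i.succ⟩
  · rintro ⟨hu, w, hR, y, rfl, rfl, hS, hy⟩
    refine ⟨Fin.cons u y, rfl, ?_, ?_, ?_⟩
    · rw [← Fin.succ_last, Fin.cons_succ]
    · intro i; cases i using Fin.cases with
      | zero => exact hu
      | succ i => exact hS i
    · intro i; cases i using Fin.cases with
      | zero => exact hR
      | succ i => exact hy i

theorem HasWalk.cons (hu : u ∈ S) (h : R u w) (hw : HasWalk S R k w v) :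
    HasWalk S R (k + 1) u v :=
  hasWalk_succ_iff.2 ⟨hu, w, h, hw⟩

theorem HasWalk.append (h : HasWalk S R k u v) (h' : HasWalk S R l v w) :
    HasWalk S R (l + k) u w := by
  induction k generalizing u with
  | zero => obtain ⟨y, rfl, rfl, -⟩ := h; exact h'
  | succ k ih =>
    obtain ⟨hu, x, hx, h⟩ := hasWalk_succ_iff.1 h
    exact (ih h).cons hu hx

theorem HasWalk.mono (hS : S ⊆ S') (hR : ∀ x y, R x y → R' x y) (h : HasWalk S R k u v) :
    HasWalk S' R' k u v := by
  obtain ⟨y, h0, h1, h2, h3⟩ := h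
  exact ⟨y, h0, h1, fun i => hS (h2 i), fun i => hR _ _ (h3 i)⟩

theorem HasWalk.right_mem (h : HasWalk S R k u v) : v ∈ S := by
  obtain ⟨y, -, rfl, h, -⟩ := h
  exact h _

theorem HasWalk.reverse (hR : ∀ x y, R x y → R y x) (h : HasWalk S R k u v) :
    HasWalk S R k v u := by
  induction k generalizing u with
  | zero => obtain ⟨y, rfl, rfl, h, -⟩ := h; exact hasWalk_zero (h 0)
  | succ k ih =>
    obtain ⟨hu, x, hx, h⟩ := hasWalk_succ_iff.1 h
    have := (ih h).append ((hasWalk_zero hu).cons (ih h).right_mem (hR _ _ hx))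
    rwa [add_comm] at this

theorem walkDist_le (h : HasWalk S R k u v) : walkDist S R u v ≤ k :=
  iInf₂_le k h

theorem walkDist_le_of_exists_le (h : ∃ k ≤ l, HasWalk S R k u v) : walkDist S R u v ≤ l := by
  obtain ⟨k, hk, h⟩ := h
  exact (walkDist_le h).trans (by exact_mod_cast hk)

end Walk

end KleeWalkup
-- The two-step walk in a two-dimensional face.
namespace KleeWalkup

/-- In a quadrilateral of consecutive vertices `p₀, p₁, p₂, p₃` of a two-dimensional face, one can
walk from `p₀` to `p₃` in two steps if `p₃` is at least as far from the edge `p₁p₂` as `p₀`. -/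
theorem exists_walk_of_le {m n : Type*} [Fintype n] [Finite m] {A : Matrix m n ℝ} {b : m → ℝ}
    {I : Set m} {j k : m} {p₀ p₁ p₂ p₃ x x' : n → ℝ}
    (h₀ : p₀ ∈ face A b I) (h₃ : p₃ ∈ (polyhedron A b).extremePoints ℝ)
    (he : face A b (insert k I) = segment ℝ p₁ p₂) (hx : x ∈ polyhedron A b)
    (hxI : tight A b x = insert k I)
    (he' : face A b (insert j I) = segment ℝ p₂ p₃) (hx' : x' ∈ polyhedron A b)
    (hxI' : tight A b x' = insert j I) (h₁₂ : p₁ ≠ p₂) (h₂₃ : p₂ ≠ p₃)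
    (hk : b k < (A *ᵥ p₀) k) (hk' : (A *ᵥ p₀) k ≤ (A *ᵥ p₃) k)
    (hj₀ : b j < (A *ᵥ p₀) j) (hj₁ : b j < (A *ᵥ p₁) j) :
    ∃ l ≤ 2, HasCircuitWalkInFace A b I l p₀ p₃ := by
  have hp₂ : p₂ ∈ face A b (insert k I) := he ▸ right_mem_segment ℝ p₁ p₂
  have hp₃ : p₃ ∈ face A b (insert j I) := he' ▸ right_mem_segment ℝ p₂ p₃
  have hk₃ : 0 < (A *ᵥ p₃) k - b k := by linarith
  -- The slack of `k` grows linearly from 0 at `p₂` to its value at `p₃`; at parameter `t` it equals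
  -- the slack at `p₀`, so `y - p₀` is parallel to the edge `p₁p₂`.
  set t := ((A *ᵥ p₀) k - b k) / ((A *ᵥ p₃) k - b k) with ht
  have ht0 : 0 < t := div_pos (by linarith) hk₃
  have ht1 : t ≤ 1 := (div_le_one hk₃).2 (by linarith)
  have hy : p₂ + t • (p₃ - p₂) ∈ face A b (insert j I) := by
    rw [he', segment_eq_image']
    exact ⟨t, ⟨ht0.le, ht1⟩, rfl⟩
  have hyk : (A *ᵥ (p₂ + t • (p₃ - p₂))) k = (A *ᵥ p₀) k := by
    rw [Matrix.mulVec_add, Matrix.mulVec_smul, Matrix.mulVec_sub]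
    simp only [Pi.add_apply, Pi.smul_apply, Pi.sub_apply, smul_eq_mul,
      hp₂.2 k (Set.mem_insert k I)]
    rw [ht, div_mul_cancel₀ _ hk₃.ne']
    ring
  set y := p₂ + t • (p₃ - p₂) with hydef
  have hyj : (A *ᵥ y) j = b j := hy.2 j (Set.mem_insert j I)
  obtain ⟨c, hc⟩ := exists_eq_smul_of_edge (d := y - p₀) he hx hxI fun i hi => by
    rw [Matrix.mulVec_sub, Pi.sub_apply, sub_eq_zero]
    rcases hi with rfl | hi
    · exact hyk
    · rw [hy.2 i (Set.mem_insert_of_mem j hi), h₀.2 i hi]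
  have hgj : (A *ᵥ (p₂ - p₁)) j < 0 := by
    have hp₂' : p₂ ∈ face A b (insert j I) := he' ▸ left_mem_segment ℝ p₂ p₃
    rw [Matrix.mulVec_sub, Pi.sub_apply, hp₂'.2 j (Set.mem_insert j I)]
    linarith
  -- Both `y - p₀` and `p₂ - p₁` decrease row `j`, so they point the same way; `j` becoming tight at
  -- `y` also makes the step maximal.
  have hc0 : 0 < c := by
    have h1 : (A *ᵥ (y - p₀)) j = c * (A *ᵥ (p₂ - p₁)) j := by
      rw [hc, Matrix.mulVec_smul, Pi.smul_apply, smul_eq_mul]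
    rw [Matrix.mulVec_sub, Pi.sub_apply, hyj] at h1
    by_contra! h2
    nlinarith [mul_nonneg_of_nonpos_of_nonpos h2 hgj.le]
  have hstep : MaximalCircuitStep A b p₀ y :=
    maximalCircuitStep_of_tight hc0 (sub_mem_circuits he hx hxI h₁₂) hc hyj hgj
  have hyI : y ∈ face A b I := face_anti (Set.subset_insert j I) hy
  have hpI : p₃ ∈ face A b I := face_anti (Set.subset_insert j I) hp₃
  -- For `t = 1` the first step already reaches `p₃`; a second one would have length zero, which is
  -- not allowed.
  rcases ht1.eq_or_lt with h | h
  · have hy3 : y = p₃ := by rw [hydef, h, one_smul, add_sub_cancel]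
    exact ⟨1, by norm_num, (hasWalk_zero hpI).cons h₀ (hy3 ▸ hstep)⟩
  · refine ⟨2, le_rfl, ((hasWalk_zero hpI).cons hyI ?_).cons h₀ hstep⟩
    refine maximalCircuitStep_of_extreme hy.1 h₃ (sub_pos.2 h)
      (sub_mem_circuits he' hx' hxI' h₂₃) ?_
    rw [hydef, sub_smul, one_smul]
    abel

/-! ### Transfer along an isomorphism of face lattices. -/

section Transfer

variable {m n : Type*} [Fintype m] [Fintype n] {A A' : Matrix m n ℝ} {b b' : m → ℝ}

/-- A face of a polyhedron, as an element of its face lattice. -/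
def faceElem (A : Matrix m n ℝ) (b : m → ℝ) (I : Set m) : Faces (polyhedron A b) :=
  ⟨face A b I, isExposed_face A b I⟩

theorem le_faceElem_iff {I : Set m} {F : Faces (polyhedron A b)} :
    F ≤ faceElem A b I ↔ ∀ i ∈ I, F ≤ faceElem A b {i} := by
  constructor
  · exact fun h i hi => h.trans (face_anti (Set.singleton_subset_iff.2 hi))
  · exact fun h x hx => ⟨F.2.subset hx, fun i hi => (h i hi hx).2 i rfl⟩

/-- In the face lattice, `face A b I` is the meet of the faces `face A b {i}` with `i ∈ I`, and an
order isomorphism preserves meets. -/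
theorem map_faceElem (Φ : Faces (polyhedron A b) ≃o Faces (polyhedron A' b'))
    (hΦ : ∀ (i : m) (F : Faces (polyhedron A b)),
      (F : Set (n → ℝ)) = face A b {i} ↔ (Φ F : Set (n → ℝ)) = face A' b' {i}) (I : Set m) :
    Φ (faceElem A b I) = faceElem A' b' I := by
  refine eq_of_forall_le_iff fun G => ?_
  have h (i : m) : Φ (faceElem A b {i}) = faceElem A' b' {i} := Subtype.ext ((hΦ i _).1 rfl)
  rw [le_faceElem_iff, ← Φ.symm_apply_le, le_faceElem_iff]
  simp only [Φ.symm_apply_le, h]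

theorem CombinatoriallyEquivalent.face_subset_iff (h : CombinatoriallyEquivalent A b A' b')
    (I J : Set m) : face A b I ⊆ face A b J ↔ face A' b' I ⊆ face A' b' J := by
  obtain ⟨Φ, hΦ⟩ := h
  change faceElem A b I ≤ faceElem A b J ↔ faceElem A' b' I ≤ faceElem A' b' J
  rw [← map_faceElem Φ hΦ, ← map_faceElem Φ hΦ, Φ.le_iff_le]

theorem CombinatoriallyEquivalent.face_eq_empty_iff (h : CombinatoriallyEquivalent A b A' b')
    (I : Set m) : face A b I = ∅ ↔ face A' b' I = ∅ := by
  obtain ⟨Φ, hΦ⟩ := h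
  have h1 : face A b I = ∅ ↔ ∀ F, faceElem A b I ≤ F :=
    ⟨fun h F => (h.le.trans (Set.empty_subset _) : face A b I ⊆ F),
      fun h => Set.subset_empty_iff.1 (h ⟨∅, isExposed_empty⟩)⟩
  have h2 : face A' b' I = ∅ ↔ ∀ F, faceElem A' b' I ≤ F :=
    ⟨fun h F => (h.le.trans (Set.empty_subset _) : face A' b' I ⊆ F),
      fun h => Set.subset_empty_iff.1 (h ⟨∅, isExposed_empty⟩)⟩
  rw [h1, h2, ← map_faceElem Φ hΦ, Φ.surjective.forall]
  simp only [Φ.le_iff_le]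

end Transfer

/-! ### Vertices and edges of an arbitrary realization. -/

variable {A : Matrix (Fin 9) (Fin 4) ℝ} {b : Fin 9 → ℝ}

theorem exists_vertexLabel_notMem : ∀ I : Finset (Fin 9), IsFaceLabel I → ∀ j ∉ I,
    ∃ s, I ⊆ vertexLabel s ∧ j ∉ vertexLabel s := by
  decide +kernel

theorem std_face_nonempty_iff (I : Finset (Fin 9)) :
    (face stdMatrix stdRhs (I : Set (Fin 9))).Nonempty ↔ IsFaceLabel I := by
  constructor
  · rintro ⟨x, hx⟩
    rcases isFaceLabel_or_missingFace_subset I with h | ⟨t, ht⟩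
    · exact h
    · exact (std_missingFace t x hx.1 fun i hi => hx.2 i (ht hi)).elim
  · rintro ⟨s, hs⟩
    obtain ⟨x, hx, h⟩ := std_vertex s
    exact ⟨x, hx, fun i hi => (h i).2 (hs hi)⟩

theorem std_not_face_subset {I : Finset (Fin 9)} (hI : IsFaceLabel I) {j : Fin 9} (hj : j ∉ I) :
    ¬ face stdMatrix stdRhs (I : Set (Fin 9)) ⊆ face stdMatrix stdRhs {j} := by
  obtain ⟨s, hs, hjs⟩ := exists_vertexLabel_notMem I hI j hj
  obtain ⟨x, hx, h⟩ := std_vertex s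
  exact fun hsub => hjs ((h j).1 ((hsub ⟨hx, fun i hi => (h i).2 (hs hi)⟩).2 j rfl))

namespace IsRealization

theorem face_nonempty_iff (hQ : IsRealization A b) (I : Finset (Fin 9)) :
    (face A b (I : Set (Fin 9))).Nonempty ↔ IsFaceLabel I := by
  rw [← std_face_nonempty_iff, Set.nonempty_iff_ne_empty, Set.nonempty_iff_ne_empty, Ne, Ne,
    hQ.2.face_eq_empty_iff]

theorem exists_mem_face_ne (hQ : IsRealization A b) {I : Finset (Fin 9)} (hI : IsFaceLabel I)
    {j : Fin 9} (hj : j ∉ I) : ∃ x ∈ face A b (I : Set (Fin 9)), (A *ᵥ x) j ≠ b j := by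
  have h := std_not_face_subset hI hj
  rw [← hQ.2.face_subset_iff, Set.not_subset] at h
  obtain ⟨x, hx, hxj⟩ := h
  exact ⟨x, hx, fun h => hxj ⟨hx.1, by rintro _ rfl; exact h⟩⟩

/-- At a point of the face with the fewest tight constraints, a further tight one would be tight on
the whole face, which the combinatorics excludes. -/
theorem exists_tight_eq (hQ : IsRealization A b) {I : Finset (Fin 9)} (hI : IsFaceLabel I) :
    ∃ x ∈ polyhedron A b, tight A b x = I := by
  obtain ⟨x, hx, hmin⟩ := exists_tight_subset (face_subset A b (I : Set (Fin 9)))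
    ((isExposed_face A b _).convex (convex_polyhedron A b)) ((hQ.face_nonempty_iff I).2 hI)
  refine ⟨x, hx.1, Set.Subset.antisymm (fun j hj => ?_) hx.2⟩
  by_contra hjI
  obtain ⟨y, hy, hyj⟩ := hQ.exists_mem_face_ne hI (Finset.mem_coe.not.1 hjI)
  exact hyj (hmin y hy hj)

theorem isFaceLabel_of_mem (hQ : IsRealization A b) {x : Fin 4 → ℝ} {I : Finset (Fin 9)}
    (hx : x ∈ face A b (I : Set (Fin 9))) : IsFaceLabel I :=
  (hQ.face_nonempty_iff I).1 ⟨x, hx⟩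

/-- The tight set at `x` extends to some vertex label; the face of that label is nonempty and
contained in `{x}`, so the two sets agree. -/
theorem exists_tight_eq_of_extreme (hQ : IsRealization A b) {x : Fin 4 → ℝ}
    (hx : x ∈ (polyhedron A b).extremePoints ℝ) : ∃ s, tight A b x = vertexLabel s := by
  classical
  obtain ⟨I, hI⟩ : ∃ I : Finset (Fin 9), (I : Set (Fin 9)) = tight A b x :=
    ⟨(tight A b x).toFinset, by simp⟩
  have h1 := face_tight_eq_singleton hx
  rw [← hI] at h1
  obtain ⟨s, hs⟩ := hQ.isFaceLabel_of_mem (h1.ge (Set.mem_singleton x))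
  obtain ⟨y, hy⟩ := (hQ.face_nonempty_iff (vertexLabel s)).2 ⟨s, Finset.Subset.refl _⟩
  have h2 : y ∈ face A b (I : Set (Fin 9)) := face_anti (Finset.coe_subset.2 hs) hy
  rw [h1, Set.mem_singleton_iff] at h2
  subst h2
  exact ⟨s, Set.Subset.antisymm (hI ▸ Finset.coe_subset.2 hs) hy.2⟩

theorem isCompact_face (hQ : IsRealization A b) (I : Set (Fin 9)) : IsCompact (face A b I) :=
  (isExposed_face A b I).isCompact
    (Metric.isCompact_of_isClosed_isBounded (isClosed_polyhedron A b) hQ.1)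

theorem exists_vertex (hQ : IsRealization A b) (s : Fin 27) :
    ∃ x, face A b (vertexLabel s : Set (Fin 9)) = {x} ∧ tight A b x = vertexLabel s := by
  obtain ⟨x, hx⟩ := (hQ.isCompact_face (vertexLabel s)).extremePoints_nonempty
    ((hQ.face_nonempty_iff _).2 ⟨s, Finset.Subset.refl _⟩)
  rw [extremePoints_face] at hx
  obtain ⟨t, ht⟩ := hQ.exists_tight_eq_of_extreme hx.2
  have h1 : vertexLabel s ⊆ vertexLabel t := Finset.coe_subset.1 (ht ▸ hx.1.2)
  have h2 : vertexLabel s = vertexLabel t :=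
    Finset.eq_of_subset_of_card_le h1 (by rw [card_vertexLabel, card_vertexLabel])
  rw [← h2] at ht
  exact ⟨x, ht ▸ face_tight_eq_singleton hx.2, ht⟩

/-- The vertices of a realization of the Klee-Walkup polytope. -/
noncomputable def vertex (hQ : IsRealization A b) (s : Fin 27) : Fin 4 → ℝ := (hQ.exists_vertex s).choose

theorem face_vertexLabel (hQ : IsRealization A b) (s : Fin 27) :
    face A b (vertexLabel s : Set (Fin 9)) = {hQ.vertex s} := (hQ.exists_vertex s).choose_spec.1

theorem tight_vertex (hQ : IsRealization A b) (s : Fin 27) :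
    tight A b (hQ.vertex s) = vertexLabel s := (hQ.exists_vertex s).choose_spec.2

theorem vertex_mem_extremePoints (hQ : IsRealization A b) (s : Fin 27) :
    hQ.vertex s ∈ (polyhedron A b).extremePoints ℝ :=
  mem_extremePoints_of_face_eq (hQ.face_vertexLabel s)

theorem vertex_mem (hQ : IsRealization A b) (s : Fin 27) : hQ.vertex s ∈ polyhedron A b :=
  (hQ.vertex_mem_extremePoints s).1

theorem vertex_injective (hQ : IsRealization A b) : Function.Injective hQ.vertex :=
  fun s t h => vertexLabel_injective <| Finset.coe_injective <| by
    rw [← hQ.tight_vertex, h, hQ.tight_vertex]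

theorem vertex_mem_face_iff (hQ : IsRealization A b) {s : Fin 27} {I : Finset (Fin 9)} :
    hQ.vertex s ∈ face A b (I : Set (Fin 9)) ↔ I ⊆ vertexLabel s := by
  rw [mem_face_iff, hQ.tight_vertex, Finset.coe_subset, and_iff_right (hQ.vertex_mem s)]

theorem eq_vertex (hQ : IsRealization A b) {x : Fin 4 → ℝ}
    (hx : x ∈ (polyhedron A b).extremePoints ℝ) : ∃ s, hQ.vertex s = x := by
  obtain ⟨s, hs⟩ := hQ.exists_tight_eq_of_extreme hx
  have h := face_tight_eq_singleton hx
  rw [hs, hQ.face_vertexLabel] at h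
  exact ⟨s, Set.singleton_injective h⟩

theorem extremePoints_face_eq (hQ : IsRealization A b) (I : Finset (Fin 9)) :
    (face A b (I : Set (Fin 9))).extremePoints ℝ = hQ.vertex '' {s | I ⊆ vertexLabel s} := by
  rw [extremePoints_face]
  ext x
  constructor
  · rintro ⟨hx, hx'⟩
    obtain ⟨s, rfl⟩ := hQ.eq_vertex hx'
    exact ⟨s, hQ.vertex_mem_face_iff.1 hx, rfl⟩
  · rintro ⟨s, hs, rfl⟩
    exact ⟨hQ.vertex_mem_face_iff.2 hs, hQ.vertex_mem_extremePoints s⟩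

theorem face_eq_segment (hQ : IsRealization A b) {s t : Fin 27}
    (h : (vertexLabel s ∩ vertexLabel t).card = 3) :
    face A b ((vertexLabel s ∩ vertexLabel t : Finset (Fin 9)) : Set (Fin 9)) =
      segment ℝ (hQ.vertex s) (hQ.vertex t) := by
  have h1 : {u | vertexLabel s ∩ vertexLabel t ⊆ vertexLabel u} = {s, t} := by
    ext u
    constructor
    · exact eq_or_eq_of_inter_subset s t u h
    · rintro (rfl | rfl)
      exacts [Finset.inter_subset_left, Finset.inter_subset_right]
  -- Krein–Milman: the compact face is the closed hull of its only two extreme points.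
  rw [← closure_convexHull_extremePoints (hQ.isCompact_face _)
    ((isExposed_face A b _).convex (convex_polyhedron A b)), hQ.extremePoints_face_eq, h1,
    Set.image_pair, convexHull_pair]
  refine IsClosed.closure_eq ?_
  rw [segment_eq_image']
  exact (isCompact_Icc.image (by fun_prop)).isClosed

theorem ne_of_card_inter {s t : Fin 27} (h : (vertexLabel s ∩ vertexLabel t).card = 3) :
    s ≠ t := by
  rintro rfl
  rw [Finset.inter_self, card_vertexLabel] at h
  omega

theorem sub_vertex_mem_circuits (hQ : IsRealization A b) {s t : Fin 27}
    (h : (vertexLabel s ∩ vertexLabel t).card = 3) :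
    hQ.vertex t - hQ.vertex s ∈ circuits A := by
  obtain ⟨x, hx, hxI⟩ := hQ.exists_tight_eq (I := vertexLabel s ∩ vertexLabel t)
    ⟨s, Finset.inter_subset_left⟩
  exact sub_mem_circuits (hQ.face_eq_segment h) hx hxI
    (hQ.vertex_injective.ne (ne_of_card_inter h))

theorem maximalCircuitStep_vertex (hQ : IsRealization A b) {s t : Fin 27}
    (h : (vertexLabel s ∩ vertexLabel t).card = 3) :
    MaximalCircuitStep A b (hQ.vertex s) (hQ.vertex t) :=
  maximalCircuitStep_of_extreme (hQ.vertex_mem s) (hQ.vertex_mem_extremePoints t) one_pos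
    (hQ.sub_vertex_mem_circuits h) (one_smul _ _).symm

theorem skeleton_adj_iff (hQ : IsRealization A b) {s t : Fin 27} :
    (skeleton (polyhedron A b)).Adj ⟨_, hQ.vertex_mem_extremePoints s⟩
      ⟨_, hQ.vertex_mem_extremePoints t⟩ ↔ (vertexLabel s ∩ vertexLabel t).card = 3 := by
  constructor
  · rintro ⟨hne, hexp⟩
    have hst : s ≠ t := by rintro rfl; exact hne rfl
    by_contra hcard
    obtain ⟨u, hus, hut, hu⟩ := exists_third_vertex s t hst hcard
    obtain ⟨x, hx, hmin⟩ := exists_tight_subset hexp.subset (convex_segment _ _)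
      ⟨_, left_mem_segment ℝ _ _⟩
    -- An exposed segment is the face of the constraints tight at its generic point; these are tight
    -- at both ends, hence at the third vertex `u`.
    have h1 : hQ.vertex u ∈ segment ℝ (hQ.vertex s) (hQ.vertex t) := by
      rw [isExposed_eq_face hexp hx hmin]
      refine ⟨hQ.vertex_mem u, fun i hi => ?_⟩
      have hs := hmin _ (left_mem_segment ℝ _ _) hi
      have ht := hmin _ (right_mem_segment ℝ _ _) hi
      simp only [hQ.tight_vertex] at hs ht
      have h2 := hu (Finset.mem_inter.2 ⟨hs, ht⟩)
      rw [← Finset.mem_coe, ← hQ.tight_vertex] at h2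
      exact h2
    rw [← insert_endpoints_openSegment] at h1
    rcases h1 with h1 | h1 | h1
    · exact hus (hQ.vertex_injective h1)
    · exact hut (hQ.vertex_injective h1)
    · exact hus.symm (hQ.vertex_injective
        ((hQ.vertex_mem_extremePoints u).2 (hQ.vertex_mem s) (hQ.vertex_mem t) h1))
  · intro h
    refine ⟨fun h' => ne_of_card_inter h (hQ.vertex_injective (congrArg Subtype.val h')), ?_⟩
    change IsExposed ℝ _ (segment ℝ (hQ.vertex s) (hQ.vertex t))
    rw [← hQ.face_eq_segment h]
    exact isExposed_face A b _

end IsRealization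
end KleeWalkup
-- Dimensions, graph distances and bounds on the circuit diameters.
namespace KleeWalkup
variable {A : Matrix (Fin 9) (Fin 4) ℝ} {b : Fin 9 → ℝ}

theorem isFaceLabel_singleton : ∀ i : Fin 9, IsFaceLabel {i} := by decide +kernel

theorem tableDist_self : ∀ s, tableDist s s = 0 := by decide +kernel

theorem MaximalCircuitStep.circuitStep {m n : Type*} [Fintype n] {A : Matrix m n ℝ} {b : m → ℝ}
    {x y : n → ℝ} (h : MaximalCircuitStep A b x y) : CircuitStep A x y := by
  obtain ⟨g, hg, α, hα, h, -⟩ := h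
  exact ⟨g, hg, α, hα, h⟩

theorem neg_mem_circuits {m n : Type*} [Fintype n] {A : Matrix m n ℝ} {g : n → ℝ}
    (h : g ∈ circuits A) : -g ∈ circuits A := by
  have : Function.support (A *ᵥ (-g)) = Function.support (A *ᵥ g) := by
    rw [Matrix.mulVec_neg]
    ext i
    simp
  exact ⟨neg_ne_zero.2 h.1, this ▸ h.2⟩

theorem CircuitStep.symm {m n : Type*} [Fintype n] {A : Matrix m n ℝ} {x y : n → ℝ}
    (h : CircuitStep A x y) : CircuitStep A y x := by
  obtain ⟨g, hg, α, hα, h⟩ := h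
  exact ⟨-g, neg_mem_circuits hg, α, hα, by rw [smul_neg, ← h, neg_sub]⟩

namespace IsRealization

theorem dim_face_union_add_card_le (hQ : IsRealization A b) (I K : Finset (Fin 9))
    (hd : Disjoint I K) (hI : IsFaceLabel (I ∪ K)) :
    dim (face A b ((I ∪ K : Finset (Fin 9)) : Set (Fin 9))) + K.card ≤
      dim (face A b (I : Set (Fin 9))) := by
  induction K using Finset.induction_on with
  | empty => simp
  | insert j K hj ih =>
    rw [Finset.disjoint_insert_right] at hd
    rw [Finset.union_insert] at hI ⊢
    obtain ⟨s, hs⟩ := hI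
    have hI' : IsFaceLabel (I ∪ K) := ⟨s, (Finset.subset_insert _ _).trans hs⟩
    have h1 := ih hd.2 hI'
    obtain ⟨y, hy, hyj⟩ := hQ.exists_mem_face_ne hI' (j := j) (by simp [hj, hd.1])
    have h2 := dim_lt_of_ssubset (A := A) (b := b)
      (face_anti (Finset.coe_subset.2 (Finset.subset_insert j (I ∪ K))))
      ((hQ.face_nonempty_iff _).2 ⟨s, hs⟩) (by simp) hy hyj
    rw [Finset.card_insert_of_notMem hj]
    omega

/-- Each added label lowers the dimension by at least one. A chain from the whole polyhedron, of
dimension at most 4, to a vertex adds four labels, so each drop is exactly one. -/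
theorem dim_face_add_card (hQ : IsRealization A b) {I : Finset (Fin 9)} (hI : IsFaceLabel I) :
    dim (face A b (I : Set (Fin 9))) + I.card = 4 := by
  have h1 := hQ.dim_face_union_add_card_le ∅ I (Finset.disjoint_empty_left I)
    (by rwa [Finset.empty_union])
  rw [Finset.empty_union] at h1
  have h2 : dim (face A b ((∅ : Finset (Fin 9)) : Set (Fin 9))) ≤ 4 :=
    (Submodule.finrank_le _).trans (by simp)
  obtain ⟨s, hs⟩ := hI
  have h3 := hQ.dim_face_union_add_card_le I (vertexLabel s \ I) Finset.disjoint_sdiff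
    ⟨s, by rw [Finset.union_sdiff_of_subset hs]⟩
  rw [Finset.card_sdiff_of_subset hs, card_vertexLabel] at h3
  omega

theorem dim_polyhedron (hQ : IsRealization A b) : dim (polyhedron A b) = 4 := by
  have h := hQ.dim_face_add_card (I := ∅) ⟨0, Finset.empty_subset _⟩
  rwa [Finset.coe_empty, face_empty, Finset.card_empty, add_zero] at h

theorem numFacets_polyhedron (hQ : IsRealization A b) : numFacets (polyhedron A b) = 9 := by
  classical
  have h : {F : Set (Fin 4 → ℝ) | IsExposed ℝ (polyhedron A b) F ∧ F.Nonempty ∧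
      dim F + 1 = dim (polyhedron A b)} =
      (fun i : Fin 9 => face A b (({i} : Finset (Fin 9)) : Set (Fin 9))) '' Set.univ := by
    ext F
    simp only [Set.mem_ofPred_eq, hQ.dim_polyhedron, Set.image_univ, Set.mem_range]
    constructor
    · rintro ⟨hF, hne, hdim⟩
      obtain ⟨x, hx, hmin⟩ := exists_tight_subset hF.subset
        (hF.convex (convex_polyhedron A b)) hne
      have hFx := isExposed_eq_face hF hx hmin
      obtain ⟨I, hI⟩ : ∃ I : Finset (Fin 9), (I : Set (Fin 9)) = tight A b x :=
        ⟨(tight A b x).toFinset, by simp⟩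
      rw [← hI] at hFx
      have h1 := hQ.dim_face_add_card (hQ.isFaceLabel_of_mem (hFx ▸ hx))
      rw [← hFx] at h1
      obtain ⟨i, rfl⟩ := Finset.card_eq_one.1 (show I.card = 1 by omega)
      exact ⟨i, hFx.symm⟩
    · rintro ⟨i, rfl⟩
      have h1 := hQ.dim_face_add_card (isFaceLabel_singleton i)
      rw [Finset.card_singleton] at h1
      exact ⟨isExposed_face A b _, (hQ.face_nonempty_iff _).2 (isFaceLabel_singleton i), by omega⟩
  rw [numFacets, h, Set.ncard_image_of_injective, Set.ncard_univ, Nat.card_fin]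
  intro i j hij
  by_contra hne
  obtain ⟨x, hx, hxj⟩ := hQ.exists_mem_face_ne (isFaceLabel_singleton i)
    (j := j) (by simpa using Ne.symm hne)
  have hx' : x ∈ face A b (({j} : Finset (Fin 9)) : Set (Fin 9)) := hij.le hx
  exact hxj (hx'.2 j (by simp))

theorem edist_vertex_le (hQ : IsRealization A b) (t : Fin 27) : ∀ (d : ℕ) (s : Fin 27),
    tableDist s t ≤ d → (skeleton (polyhedron A b)).edist ⟨_, hQ.vertex_mem_extremePoints s⟩
      ⟨_, hQ.vertex_mem_extremePoints t⟩ ≤ d := by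
  intro d
  induction d with
  | zero =>
    intro s hs
    by_cases hst : s = t
    · subst hst; simp
    · obtain ⟨u, -, hu⟩ := exists_tableDist_lt s t hst
      omega
  | succ d ih =>
    intro s hs
    by_cases hst : s = t
    · subst hst; simp
    · obtain ⟨u, hsu, hu⟩ := exists_tableDist_lt s t hst
      refine (SimpleGraph.edist_triangle (v := ⟨_, hQ.vertex_mem_extremePoints u⟩)).trans ?_
      rw [SimpleGraph.edist_eq_one_iff_adj.2 (hQ.skeleton_adj_iff.2 hsu), Nat.cast_succ, add_comm]
      exact add_le_add_left (ih u (by omega)) 1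

theorem tableDist_le_length (hQ : IsRealization A b) (t : Fin 27)
    {x y : (polyhedron A b).extremePoints ℝ} (p : (skeleton (polyhedron A b)).Walk x y)
    (hy : y = hQ.vertex t) : ∀ s, x = hQ.vertex s → tableDist s t ≤ p.length := by
  induction p with
  | nil =>
    intro s hs
    obtain rfl := hQ.vertex_injective (hs.symm.trans hy)
    exact (tableDist_self s).le
  | @cons x z y h p ih =>
    intro s hs
    obtain ⟨u, hu⟩ := hQ.eq_vertex z.2
    have h1 := ih hy u hu.symm
    have h2 := tableDist_le_succ s u t (hQ.skeleton_adj_iff.1 (by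
      convert h using 1
      · exact Subtype.ext hs.symm
      · exact Subtype.ext hu))
    rw [SimpleGraph.Walk.length_cons]
    omega

theorem graphDiam_polyhedron (hQ : IsRealization A b) : graphDiam (polyhedron A b) = 5 := by
  refine le_antisymm (SimpleGraph.ediam_le_iff.2 ?_) ?_
  · rintro ⟨x, hx⟩ ⟨y, hy⟩
    obtain ⟨s, rfl⟩ := hQ.eq_vertex hx
    obtain ⟨t, rfl⟩ := hQ.eq_vertex hy
    exact hQ.edist_vertex_le t 5 s (tableDist_le s t)
  · refine le_trans ?_ (SimpleGraph.edist_le_ediam (u := ⟨_, hQ.vertex_mem_extremePoints 0⟩)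
      (v := ⟨_, hQ.vertex_mem_extremePoints 24⟩))
    rw [SimpleGraph.edist_eq_sInf]
    refine le_sInf ?_
    rintro _ ⟨p, rfl⟩
    have h : 5 ≤ p.length := hQ.tableDist_le_length 24 p rfl 0 rfl
    change ((5 : ℕ) : ℕ∞) ≤ (p.length : ℕ∞)
    exact_mod_cast h

theorem exists_edge_walk (hQ : IsRealization A b) (t : Fin 27) : ∀ (d : ℕ) (s : Fin 27),
    tableDist s t ≤ d → ∃ k ≤ d, HasCircuitWalk A b k (hQ.vertex s) (hQ.vertex t) := by
  intro d
  induction d with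
  | zero =>
    intro s hs
    by_cases hst : s = t
    · subst hst; exact ⟨0, le_rfl, hasWalk_zero (hQ.vertex_mem s)⟩
    · obtain ⟨u, -, hu⟩ := exists_tableDist_lt s t hst
      omega
  | succ d ih =>
    intro s hs
    by_cases hst : s = t
    · subst hst; exact ⟨0, Nat.zero_le _, hasWalk_zero (hQ.vertex_mem s)⟩
    · obtain ⟨u, hsu, hu⟩ := exists_tableDist_lt s t hst
      obtain ⟨k, hk, h⟩ := ih u (by omega)
      exact ⟨k + 1, by omega, h.cons (hQ.vertex_mem s) (hQ.maximalCircuitStep_vertex hsu)⟩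

theorem lt_mulVec_vertex (hQ : IsRealization A b) {s : Fin 27} {i : Fin 9}
    (h : i ∉ vertexLabel s) : b i < (A *ᵥ hQ.vertex s) i := by
  refine lt_of_le_of_ne (hQ.vertex_mem s i) fun h' => h ?_
  rw [← Finset.mem_coe, ← hQ.tight_vertex]
  exact h'.symm

theorem exists_walk_in_face_of_le (hQ : IsRealization A b) {I : Finset (Fin 9)}
    {j k : Fin 9} {s₀ s₁ s₂ s₃ : Fin 27}
    (h₀ : I ⊆ vertexLabel s₀) (hk : k ∉ vertexLabel s₀) (hj₀ : j ∉ vertexLabel s₀)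
    (hj₁ : j ∉ vertexLabel s₁)
    (h₁₂ : vertexLabel s₁ ∩ vertexLabel s₂ = insert k I)
    (h₂₃ : vertexLabel s₂ ∩ vertexLabel s₃ = insert j I)
    (hck : (insert k I).card = 3) (hcj : (insert j I).card = 3)
    (hle : (A *ᵥ hQ.vertex s₀) k ≤ (A *ᵥ hQ.vertex s₃) k) :
    ∃ l ≤ 2, HasCircuitWalkInFace A b I l (hQ.vertex s₀) (hQ.vertex s₃) := by
  have c₁₂ : (vertexLabel s₁ ∩ vertexLabel s₂).card = 3 := by rw [h₁₂, hck]
  have c₂₃ : (vertexLabel s₂ ∩ vertexLabel s₃).card = 3 := by rw [h₂₃, hcj]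
  have e₁₂ := hQ.face_eq_segment c₁₂
  have e₂₃ := hQ.face_eq_segment c₂₃
  obtain ⟨x, hx, hxI⟩ := hQ.exists_tight_eq (I := vertexLabel s₁ ∩ vertexLabel s₂)
    ⟨s₁, Finset.inter_subset_left⟩
  obtain ⟨x', hx', hxI'⟩ := hQ.exists_tight_eq (I := vertexLabel s₂ ∩ vertexLabel s₃)
    ⟨s₂, Finset.inter_subset_left⟩
  rw [h₁₂, Finset.coe_insert] at e₁₂ hxI
  rw [h₂₃, Finset.coe_insert] at e₂₃ hxI'
  exact exists_walk_of_le (hQ.vertex_mem_face_iff.2 h₀) (hQ.vertex_mem_extremePoints s₃)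
    e₁₂ hx hxI e₂₃ hx' hxI' (hQ.vertex_injective.ne (ne_of_card_inter c₁₂))
    (hQ.vertex_injective.ne (ne_of_card_inter c₂₃)) (hQ.lt_mulVec_vertex hk) hle
    (hQ.lt_mulVec_vertex hj₀) (hQ.lt_mulVec_vertex hj₁)

/-- On the 7-gon cut out by the facets 1 and 4, one can walk in two steps between the vertices
1234 and 1478, in at least one direction. -/
theorem heptagon_walk (hQ : IsRealization A b) :
    (∃ k ≤ 2, HasCircuitWalkInFace A b {0, 3} k (hQ.vertex 0) (hQ.vertex 8)) ∨
      ∃ k ≤ 2, HasCircuitWalkInFace A b {0, 3} k (hQ.vertex 8) (hQ.vertex 0) := by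
  have hI : (({0, 3} : Finset (Fin 9)) : Set (Fin 9)) = {0, 3} := by simp
  rw [← hI]
  -- Row 4 is facet 5, which carries the middle edge between vertices 3 and 5 (V1345 and V1458); the
  -- comparison of slacks selects the direction.
  rcases le_total ((A *ᵥ hQ.vertex 0) 4) ((A *ᵥ hQ.vertex 8) 4) with h | h
  · exact Or.inl (hQ.exists_walk_in_face_of_le (j := 7) (s₁ := 3) (s₂ := 5) (by decide) (by decide)
      (by decide) (by decide) (by decide) (by decide) (by decide) (by decide) h)
  · exact Or.inr (hQ.exists_walk_in_face_of_le (j := 2) (s₁ := 5) (s₂ := 3) (by decide) (by decide)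
      (by decide) (by decide) (by decide) (by decide) (by decide) (by decide) h)

theorem exists_walk_of_antipodal (hQ : IsRealization A b) :
    (∃ k ≤ 4, HasCircuitWalk A b k (hQ.vertex 0) (hQ.vertex 24)) ∨
      ∃ k ≤ 4, HasCircuitWalk A b k (hQ.vertex 24) (hQ.vertex 0) := by
  rcases hQ.heptagon_walk with ⟨k, hk, h⟩ | ⟨k, hk, h⟩
  -- The remaining two edges, between V1478 and V5678, can be used in either direction.
  · obtain ⟨l, hl, h'⟩ := hQ.exists_edge_walk 24 2 8 (by decide)
    exact Or.inl ⟨l + k, by omega, (h.mono (face_subset A b _) fun _ _ h => h).append h'⟩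
  · obtain ⟨l, hl, h'⟩ := hQ.exists_edge_walk 8 2 24 (by decide)
    exact Or.inr ⟨k + l, by omega, h'.append (h.mono (face_subset A b _) fun _ _ h => h)⟩

theorem exists_walk_or (hQ : IsRealization A b) (s t : Fin 27) :
    (∃ k ≤ 4, HasCircuitWalk A b k (hQ.vertex s) (hQ.vertex t)) ∨
      ∃ k ≤ 4, HasCircuitWalk A b k (hQ.vertex t) (hQ.vertex s) := by
  rcases tableDist_le_four s t with h | ⟨rfl, rfl⟩ | ⟨rfl, rfl⟩
  · exact Or.inl (hQ.exists_edge_walk t 4 s h)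
  · exact hQ.exists_walk_of_antipodal
  · exact hQ.exists_walk_of_antipodal.symm

theorem symmCircuitDiam_le (hQ : IsRealization A b) : symmCircuitDiam A b ≤ 4 := by
  refine iSup₂_le fun x hx => iSup₂_le fun y hy => ?_
  obtain ⟨s, rfl⟩ := hQ.eq_vertex hx
  obtain ⟨t, rfl⟩ := hQ.eq_vertex hy
  exact min_le_iff.2 ((hQ.exists_walk_or s t).imp walkDist_le_of_exists_le
    walkDist_le_of_exists_le)

theorem feasibleCircuitDiam_le (hQ : IsRealization A b) : feasibleCircuitDiam A b ≤ 4 := by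
  refine iSup₂_le fun x hx => iSup₂_le fun y hy => ?_
  obtain ⟨s, rfl⟩ := hQ.eq_vertex hx
  obtain ⟨t, rfl⟩ := hQ.eq_vertex hy
  refine walkDist_le_of_exists_le (l := 4) ?_
  rcases hQ.exists_walk_or s t with ⟨k, hk, h⟩ | ⟨k, hk, h⟩
  · exact ⟨k, hk, h.mono subset_rfl fun _ _ => MaximalCircuitStep.circuitStep⟩
  · exact ⟨k, hk, (h.mono subset_rfl fun _ _ => MaximalCircuitStep.circuitStep).reverse
      fun _ _ => CircuitStep.symm⟩

end IsRealization

theorem softCircuitDiam_le_feasibleCircuitDiam {m n : Type*} [Fintype n] (A : Matrix m n ℝ)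
    (b : m → ℝ) : softCircuitDiam A b ≤ feasibleCircuitDiam A b :=
  iSup₂_mono fun _ _ => iSup₂_mono fun _ _ => le_iInf₂ fun _ hk =>
    walkDist_le (hk.mono (Set.subset_univ _) fun _ _ h => h)

theorem IsRealization.not_isHirschSharp (hQ : IsRealization A b) {δ : ℕ∞} (hδ : δ ≤ 4) :
    ¬ IsHirschSharp (polyhedron A b) δ := by
  rw [IsHirschSharp, hQ.dim_polyhedron, hQ.numFacets_polyhedron]
  intro h
  have h1 : δ + (4 : ℕ) ≤ 4 + (4 : ℕ) := by gcongr
  rw [h] at h1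
  exact absurd h1 (by decide)

end KleeWalkup

theorem mainTheorem2 (A : Matrix (Fin 9) (Fin 4) ℝ) (b : Fin 9 → ℝ)
    (hQ : KleeWalkup.IsRealization A b) :
    -- dimension 4, nine facets, graph diameter 5 (the Hirsch bound is attained)
    (KleeWalkup.dim (KleeWalkup.polyhedron A b) = 4 ∧
      KleeWalkup.numFacets (KleeWalkup.polyhedron A b) = 9 ∧
      KleeWalkup.graphDiam (KleeWalkup.polyhedron A b) = 5 ∧
      KleeWalkup.IsHirschSharp (KleeWalkup.polyhedron A b)
        (KleeWalkup.graphDiam (KleeWalkup.polyhedron A b))) ∧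
    -- the face cut out by the facets 1 and 4 is a 7-gon
    (KleeWalkup.dim (KleeWalkup.face A b {0, 3}) = 2 ∧
      ((KleeWalkup.face A b {0, 3}).extremePoints ℝ).ncard = 7) ∧
    -- the vertices V1234, V5678, V1478
    (∃ v1234 v5678 v1478 : Fin 4 → ℝ,
      KleeWalkup.face A b {0, 1, 2, 3} = {v1234} ∧
      KleeWalkup.face A b {4, 5, 6, 7} = {v5678} ∧
      KleeWalkup.face A b {0, 3, 6, 7} = {v1478} ∧
      -- the dichotomy on the 7-gon
      ((¬ ∃ k ≤ 2, KleeWalkup.HasCircuitWalkInFace A b {0, 3} k v1478 v1234) →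
        ∃ k ≤ 2, KleeWalkup.HasCircuitWalkInFace A b {0, 3} k v1234 v1478) ∧
      -- a circuit walk of length at most 4 in at least one direction
      ((∃ k ≤ 4, KleeWalkup.HasCircuitWalk A b k v1234 v5678) ∨
        ∃ k ≤ 4, KleeWalkup.HasCircuitWalk A b k v5678 v1234)) ∧
    -- the symmetric variants of the circuit diameter are at most 4, hence not Hirsch-sharp
    (KleeWalkup.symmCircuitDiam A b ≤ 4 ∧
      ¬ KleeWalkup.IsHirschSharp (KleeWalkup.polyhedron A b) (KleeWalkup.symmCircuitDiam A b)) ∧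
    (KleeWalkup.feasibleCircuitDiam A b ≤ 4 ∧
      ¬ KleeWalkup.IsHirschSharp (KleeWalkup.polyhedron A b)
        (KleeWalkup.feasibleCircuitDiam A b)) ∧
    (KleeWalkup.softCircuitDiam A b ≤ 4 ∧
      ¬ KleeWalkup.IsHirschSharp (KleeWalkup.polyhedron A b)
        (KleeWalkup.softCircuitDiam A b)) := by
  have hsoft := (KleeWalkup.softCircuitDiam_le_feasibleCircuitDiam A b).trans hQ.feasibleCircuitDiam_le
  have hI : (({0, 3} : Finset (Fin 9)) : Set (Fin 9)) = {0, 3} := by simp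
  have hF (s : Fin 27) (i j k l : Fin 9) (h : KleeWalkup.vertexLabel s = {i, j, k, l}) :
      KleeWalkup.face A b {i, j, k, l} = {hQ.vertex s} := by
    rw [← hQ.face_vertexLabel, h]
    simp
  refine ⟨⟨hQ.dim_polyhedron, hQ.numFacets_polyhedron, hQ.graphDiam_polyhedron, ?_⟩, ⟨?_, ?_⟩,
    ⟨hQ.vertex 0, hQ.vertex 24, hQ.vertex 8, hF 0 _ _ _ _ rfl, hF 24 _ _ _ _ rfl,
      hF 8 _ _ _ _ rfl, hQ.heptagon_walk.resolve_right, hQ.exists_walk_of_antipodal⟩,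
    ⟨hQ.symmCircuitDiam_le, hQ.not_isHirschSharp hQ.symmCircuitDiam_le⟩,
    ⟨hQ.feasibleCircuitDiam_le, hQ.not_isHirschSharp hQ.feasibleCircuitDiam_le⟩,
    ⟨hsoft, hQ.not_isHirschSharp hsoft⟩⟩
  · rw [KleeWalkup.IsHirschSharp, hQ.dim_polyhedron, hQ.numFacets_polyhedron,
      hQ.graphDiam_polyhedron]
    norm_num
  · have h := hQ.dim_face_add_card (I := {0, 3}) (by decide)
    rw [hI, show ({0, 3} : Finset (Fin 9)).card = 2 from rfl] at h
    omega
  · rw [← hI, hQ.extremePoints_face_eq, Set.ncard_image_of_injective _ hQ.vertex_injective,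
      Set.ncard_eq_toFinset_card']
    decide +kernel
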